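/- Let $(W,S)$, $S=\{s_1,s_2,s_3\}$, be a Coxeter system of affine type of rank two, with $m_{ij}$ the order of $s_is_j$, labelled so that $(m_{12},m_{23},m_{13})$ is $(3,3,3)$ (type $\tilde A_2$), $(4,2,4)$ (type $\tilde C_2$) or $(6,2,3)$ (type $\tilde G_2$); let $\ell$ be its length function. Put $$(w_1,w_2)=\begin{cases}(s_3s_2s_1,\ s_3s_1s_2) & \text{type } \tilde A_2,\\ (s_3s_1s_2s_1,\ s_3s_1s_2) & \text{type } \tilde C_2,\\ (s_3s_1s_2,\ s_3s_1s_2s_1s_2) & \text{type } \tilde G_2,\end{cases}$$ and $H_i=\{w_i^n : n\ge 0\}$ for $i=1,2$. Let $k$ be a field, let $q\in k$, and let $H_q(W,S)$ be the Hecke algebra: the associative unital $k$-algebra with generators $e_w$ $(w\in W)$ and relations $e_1=1$, $(e_s+1)(e_s-q)=0$ for $s\in S$, and $e_we_v=e_{wv}$ whenever $\ell(wv)=\ell(w)+\ell(v)$. Let $\rho\colon H_q(W,S)\to \mathrm{End}_k(V)$ be a representation on a finite-dimensional $k$-vector space $V$. For $D\subseteq W$ put $$D(\rho,u)=\sum_{w\in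 D}\rho(e_w)u^{\ell(w)}\in \mathrm{End}_k(V)[[u]],$$ and let $\det D(\rho,u)\in k[[u]]$ be its determinant. For $I\subseteq S$ let $W_I$ be the subgroup of $W$ generated by $I$, and put $$\det \mathrm{Alt}(W)(\rho,u)=\prod_{I\subseteq S}\bigl(\det W_I(\rho,u)\bigr)^{(-1)^{|I|+|S|}},$$ where the inverses exist because each $\det W_I(\rho,u)$ has constant term $1$. Then $$\det H_1(\rho,u)\cdot\det H_2(\rho,u)=\det \mathrm{Alt}(W)(\rho,u)\quad\text{in } k[[u]].$$ -/

import Mathlib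

open PowerSeries

noncomputable section

/-- The three types of affine Coxeter groups of rank two. -/
inductive AffineType
  | A2
  | C2
  | G2

/-- The Coxeter matrices `(m_ij)` of the three types; the indices `0, 1, 2` stand for the
generators `s_1, s_2, s_3`.  The values of `(m_12, m_23, m_13)` are `(3, 3, 3)`, `(4, 2, 4)`
and `(6, 2, 3)`. -/
def AffineType.coxeterMatrix : AffineType → CoxeterMatrix (Fin 3)
  | .A2 =>
    { M := !![1, 3, 3;
              3, 1, 3;
              3, 3, 1]
      isSymm := by decide
      diagonal := by decide
      off_diagonal := by intro i j h; fin_cases i <;> fin_cases j <;> simp_all }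
  | .C2 =>
    { M := !![1, 4, 4;
              4, 1, 2;
              4, 2, 1]
      isSymm := by decide
      diagonal := by decide
      off_diagonal := by intro i j h; fin_cases i <;> fin_cases j <;> simp_all }
  | .G2 =>
    { M := !![1, 6, 3;
              6, 1, 2;
              3, 2, 1]
      isSymm := by decide
      diagonal := by decide
      off_diagonal := by intro i j h; fin_cases i <;> fin_cases j <;> simp_all }

section Hecke

variable {B : Type*} {M : CoxeterMatrix B} {W : Type*} [Group W] {k : Type*} [Field k]

/-- The defining relations of the Hecke algebra, between generators `e_w`, `w ∈ W`:
`e_1 = 1`, `(e_s + 1)(e_s - q) = 0` for the simple reflections `s`, and `e_w e_v = e_{wv}`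
whenever `ℓ(wv) = ℓ(w) + ℓ(v)`. -/
inductive HeckeRel (cs : CoxeterSystem M W) (q : k) : FreeAlgebra k W → FreeAlgebra k W → Prop
  | one : HeckeRel cs q (FreeAlgebra.ι k 1) 1
  | quadratic (i : B) : HeckeRel cs q
      ((FreeAlgebra.ι k (cs.simple i) + 1) *
        (FreeAlgebra.ι k (cs.simple i) - algebraMap k (FreeAlgebra k W) q)) 0
  | mul (w v : W) (h : cs.length (w * v) = cs.length w + cs.length v) : HeckeRel cs q
      (FreeAlgebra.ι k w * FreeAlgebra.ι k v) (FreeAlgebra.ι k (w * v))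

/-- The Hecke algebra `H_q(W, S)` over the field `k` with parameter `q ∈ k`. -/
def HeckeAlgebra (cs : CoxeterSystem M W) (q : k) : Type _ := RingQuot (HeckeRel cs q)

instance (cs : CoxeterSystem M W) (q : k) : Ring (HeckeAlgebra cs q) :=
  inferInstanceAs (Ring (RingQuot (HeckeRel cs q)))

instance (cs : CoxeterSystem M W) (q : k) : Algebra k (HeckeAlgebra cs q) :=
  inferInstanceAs (Algebra k (RingQuot (HeckeRel cs q)))

/-- The generator `e_w` of the Hecke algebra. -/
def HeckeAlgebra.e (cs : CoxeterSystem M W) (q : k) (w : W) : HeckeAlgebra cs q :=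
  RingQuot.mkAlgHom k (HeckeRel cs q) (FreeAlgebra.ι k w)

theorem CoxeterSystem.finite_length_eq [Finite B] (cs : CoxeterSystem M W) (D : Set W) (n : ℕ) :
    {w | w ∈ D ∧ cs.length w = n}.Finite := by
  refine ((List.finite_length_eq B n).image cs.wordProd).subset ?_
  rintro w ⟨-, hw⟩
  obtain ⟨ω, hω, rfl⟩ := cs.exists_isReduced w
  exact ⟨ω, hω.symm.trans hw, rfl⟩

/-- The twisted Poincaré series `D(ρ, u) = ∑_{w ∈ D} ρ(e_w) u^{ℓ(w)}` in `End(V)[[u]]`: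
its `n`-th coefficient is the sum of `ρ(e_w)` over the finitely many `w ∈ D` of length `n`. -/
def twistedPoincare [Finite B] (cs : CoxeterSystem M W) {q : k} {V : Type*} [AddCommGroup V]
    [Module k V] (ρ : HeckeAlgebra cs q →ₐ[k] Module.End k V) (D : Set W) :
    PowerSeries (Module.End k V) :=
  PowerSeries.mk fun n =>
    ∑ w ∈ (cs.finite_length_eq D n).toFinset, ρ (HeckeAlgebra.e cs q w)

end Hecke

section Det

variable {k : Type*} [Field k] {V : Type*} [AddCommGroup V] [Module k V]

/-- The matrix over `k[[u]]` of a power series with coefficients in `End(V)`, in a basis. -/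
def seriesMatrix {ι : Type*} [Fintype ι] [DecidableEq ι] (b : Module.Basis ι k V)
    (F : PowerSeries (Module.End k V)) : Matrix ι ι k⟦X⟧ :=
  Matrix.of fun i j => PowerSeries.mk fun n => LinearMap.toMatrix b b (coeff n F) i j

/-- The determinant in `k[[u]]` of an element of `End(V)[[u]]`, for `V` finite-dimensional. -/
def seriesDet [FiniteDimensional k V] (F : PowerSeries (Module.End k V)) : k⟦X⟧ :=
  (seriesMatrix (Module.finBasis k V) F).det

theorem seriesMatrix_mul {ι : Type*} [Fintype ι] [DecidableEq ι] (b : Module.Basis ι k V)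
    (F G : PowerSeries (Module.End k V)) :
    seriesMatrix b (F * G) = seriesMatrix b F * seriesMatrix b G := by
  ext i j n
  simp only [seriesMatrix, Matrix.of_apply, coeff_mk, PowerSeries.coeff_mul, Matrix.mul_apply,
    map_sum, Matrix.sum_apply, LinearMap.toMatrix_mul]
  rw [Finset.sum_comm]

/-- The determinant does not depend on the basis. -/
theorem seriesDet_eq [FiniteDimensional k V] {ι : Type*} [Fintype ι] [DecidableEq ι]
    (b : Module.Basis ι k V) (F : PowerSeries (Module.End k V)) :
    seriesDet F = (seriesMatrix b F).det := by
  let b' := Module.finBasis k V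
  let P : Matrix (Fin (Module.finrank k V)) ι k⟦X⟧ := (b'.toMatrix b).map (C (R := k))
  let Q : Matrix ι (Fin (Module.finrank k V)) k⟦X⟧ := (b.toMatrix b').map (C (R := k))
  have hPQ : P * Q = 1 := by
    rw [← Matrix.map_mul, Module.Basis.toMatrix_mul_toMatrix_flip]
    exact Matrix.map_one _ (map_zero _) (map_one _)
  have hQP : Q * P = 1 := by
    rw [← Matrix.map_mul, Module.Basis.toMatrix_mul_toMatrix_flip]
    exact Matrix.map_one _ (map_zero _) (map_one _)
  have h : seriesMatrix b' F = P * seriesMatrix b F * Q := by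
    ext i j n
    have h := congrFun (congrFun
      (basis_toMatrix_mul_linearMap_toMatrix_mul_basis_toMatrix b' b b' b (coeff n F)) i) j
    simp only [seriesMatrix, Matrix.of_apply, coeff_mk]
    rw [← h]
    simp only [P, Q, Matrix.mul_apply, map_sum, coeff_C_mul, coeff_mul_C,
      Matrix.map_apply, Matrix.of_apply, coeff_mk]
  change (seriesMatrix b' F).det = _
  rw [h, Matrix.det_conj_of_mul_eq_one hPQ hQP]

/-- A series with constant term the identity has a determinant with constant coefficient `1`. -/
theorem constantCoeff_seriesDet [FiniteDimensional k V] (F : PowerSeries (Module.End k V))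
    (hF : coeff 0 F = 1) : constantCoeff (seriesDet F) = 1 := by
  have h : (constantCoeff (R := k)).mapMatrix (seriesMatrix (Module.finBasis k V) F) = 1 := by
    ext i j
    rw [← LinearMap.toMatrix_one (Module.finBasis k V), ← hF]
    rw [RingHom.mapMatrix_apply, Matrix.map_apply, seriesMatrix, Matrix.of_apply,
      ← coeff_zero_eq_constantCoeff_apply, coeff_mk]
  rw [seriesDet, RingHom.map_det, h, Matrix.det_one]

end Det

theorem coeff_zero_twistedPoincare {B : Type*} [Finite B] {M : CoxeterMatrix B} {W : Type*}
    [Group W] {k : Type*} [Field k] (cs : CoxeterSystem M W) {q : k} {V : Type*}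
    [AddCommGroup V] [Module k V] (ρ : HeckeAlgebra cs q →ₐ[k] Module.End k V) (D : Set W)
    (hD : 1 ∈ D) : coeff 0 (twistedPoincare cs ρ D) = 1 := by
  have h1 : (cs.finite_length_eq D 0).toFinset = {1} := by
    ext w
    simp only [Set.Finite.mem_toFinset, Set.mem_ofPred_eq, Finset.mem_singleton,
      cs.length_eq_zero_iff]
    exact ⟨fun h => h.2, fun h => ⟨h ▸ hD, h⟩⟩
  have h2 : HeckeAlgebra.e cs q 1 = 1 :=
    (RingQuot.mkAlgHom_rel k (HeckeRel.one (cs := cs) (q := q))).trans (map_one _)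
  rw [twistedPoincare, coeff_mk, h1, Finset.sum_singleton, h2, map_one]

section Alt

variable {M : CoxeterMatrix (Fin 3)} {W : Type*} [Group W] {k : Type*} [Field k]

/-- The standard parabolic subgroup `W_I`, generated by the `s_i` with `i ∈ I`. -/
def parabolic (cs : CoxeterSystem M W) (I : Finset (Fin 3)) : Subgroup W :=
  Subgroup.closure (cs.simple '' (I : Set (Fin 3)))

/-- `det Alt(W)(ρ, u)`, the product over all `I ⊆ S` of `det W_I(ρ, u)` raised to the power
`(-1)^(|I| + |S|)`, where `|S| = 3`.  The inverses are those of power series with constant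
coefficient `1`. -/
def detAlt (cs : CoxeterSystem M W) {q : k} {V : Type*} [AddCommGroup V] [Module k V]
    [FiniteDimensional k V] (ρ : HeckeAlgebra cs q →ₐ[k] Module.End k V) : k⟦X⟧ :=
  ∏ I : Finset (Fin 3),
    if Even (I.card + 3) then seriesDet (twistedPoincare cs ρ (parabolic cs I))
    else (seriesDet (twistedPoincare cs ρ (parabolic cs I)))⁻¹

end Alt

section Strips

variable {W : Type*} [Group W]

/-- The element `w_1`, a generator of the stabilizer of a straight strip of the first kind. -/
def stripElement₁ (T : AffineType) (cs : CoxeterSystem T.coxeterMatrix W) : W :=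
  let s₁ := cs.simple 0
  let s₂ := cs.simple 1
  let s₃ := cs.simple 2
  match T with
  | .A2 => s₃ * s₂ * s₁
  | .C2 => s₃ * s₁ * s₂ * s₁
  | .G2 => s₃ * s₁ * s₂

/-- The element `w_2`, a generator of the stabilizer of a straight strip of the second kind. -/
def stripElement₂ (T : AffineType) (cs : CoxeterSystem T.coxeterMatrix W) : W :=
  let s₁ := cs.simple 0
  let s₂ := cs.simple 1
  let s₃ := cs.simple 2
  match T with
  | .A2 => s₃ * s₁ * s₂
  | .C2 => s₃ * s₁ * s₂
  | .G2 => s₃ * s₁ * s₂ * s₁ * s₂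

/-- The set `{w ^ n | n ≥ 0}`. -/
def powersSet (w : W) : Set W := Set.range fun n : ℕ => w ^ n

end Strips

end

/-!
Sorting the elements of `W` by their left descents gives `∑ (-1)^|I| W_I(u)⁻¹ = 0` by inclusion and
exclusion, since no element of an infinite Coxeter group has all generators as left descents. This
expresses `W(u)⁻¹` through the rank-one and rank-two series, which are polynomials in the terms
`a, b, c` of the three generators. After multiplication by factors of the rank-two series, the braid
relations and `det (1 - xy) = det (1 - yx)` turn `det W(u)⁻¹` into `det (1 - x₁) * det (1 - x₂)`,
where `x₁, x₂` are the products of `a, b, c` along the words of `w₁, w₂`. These words are straight: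
every letter of a power crosses a new hyperplane along a strip of alcoves. Hence lengths add along
the powers of `w_i`, and `H_i(u)` is the geometric series `(1 - x_i)⁻¹`.
-/

section Exchange

open CoxeterSystem

variable {B : Type*} {M : CoxeterMatrix B} {W : Type*} [Group W] (cs : CoxeterSystem M W)

open Classical in
/-- The action of a simple reflection on pairs consisting of a group element and a sign:
conjugation, with a change of sign at the reflection itself.  It extends to an action of the whole
group, whose signs record the parities of multiplicities in inversion sequences. -/
noncomputable def signedConj (i : B) : Function.End (W × ZMod 2) := fun p =>
  (cs.simple i * p.1 * cs.simple i, p.2 + if p.1 = cs.simple i then 1 else 0)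

open Classical in
theorem prod_map_signedConj (ω : List B) (p : W × ZMod 2) :
    (ω.map (signedConj cs)).prod p =
      (cs.wordProd ω * p.1 * (cs.wordProd ω)⁻¹,
        p.2 + ((cs.rightInvSeq ω).count p.1 : ZMod 2)) := by
  induction ω with
  | nil => simp [Function.End.one_def]
  | cons i ω ih =>
    have conj_eq_iff : cs.wordProd ω * p.1 * (cs.wordProd ω)⁻¹ = cs.simple i ↔
        (cs.wordProd ω)⁻¹ * cs.simple i * cs.wordProd ω = p.1 := by
      rw [mul_inv_eq_iff_eq_mul, mul_assoc, inv_mul_eq_iff_eq_mul, eq_comm]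
    have hcons : ((i :: ω).map (signedConj cs)).prod p =
        signedConj cs i ((ω.map (signedConj cs)).prod p) := by
      rw [List.map_cons, List.prod_cons]; rfl
    rw [hcons, ih]
    simp only [signedConj, wordProd_cons, rightInvSeq, List.count_cons, conj_eq_iff, mul_inv_rev,
      inv_simple, beq_iff_eq, Nat.cast_add, Nat.cast_ite, Nat.cast_one, Nat.cast_zero, add_assoc]
    simp only [mul_assoc]

theorem prod_map_reverse_alternatingWord {G : Type*} [Monoid G] (f : B → G) (i j : B) (n : ℕ) :
    ((alternatingWord i j (2 * n)).reverse.map f).prod = (f j * f i) ^ n := by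
  induction n with
  | zero => simp [alternatingWord]
  | succ n ih =>
    rw [mul_add_one, alternatingWord_succ', alternatingWord_succ']
    rw [pow_succ, ← ih]
    simp [-List.map_reverse]

theorem leftInvSeq_alternatingWord (i j : B) (n : ℕ) :
    cs.leftInvSeq (alternatingWord i j (2 * n)) =
      (List.range (2 * n)).map fun k => cs.wordProd (alternatingWord j i (2 * k + 1)) := by
  refine List.ext_getElem (by simp) fun k hk _ => ?_
  rw [cs.getElem_leftInvSeq_alternatingWord i j n k (by simpa using hk)]
  simp

open Classical in
theorem even_count_leftInvSeq_alternatingWord (i j : B) (t : W) :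
    Even ((cs.leftInvSeq (alternatingWord i j (2 * M i j))).count t) := by
  have periodic :
      ((fun k => cs.wordProd (alternatingWord j i (2 * k + 1))) ∘ fun k => M i j + k) =
        fun k => cs.wordProd (alternatingWord j i (2 * k + 1)) := by
    funext k
    have hshift : (2 * (M i j + k) + 1) / 2 = M i j + k := by lia
    have hhalf : (2 * k + 1) / 2 = k := by lia
    simp [prod_alternatingWord_eq_mul_pow, hshift, hhalf, pow_add]
  rw [leftInvSeq_alternatingWord, two_mul, List.range_add, List.map_append, List.count_append,
    List.map_map, periodic]
  exact Even.add_self _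

theorem isLiftable_signedConj : M.IsLiftable (signedConj cs) := by
  classical
  intro i j
  funext p
  have hone : cs.wordProd (alternatingWord j i (2 * M j i)).reverse = 1 := by
    rw [wordProd, prod_map_reverse_alternatingWord, M.symmetric, simple_mul_simple_pow]
  have heven := even_count_leftInvSeq_alternatingWord cs j i p.1
  rw [← List.count_reverse, ← rightInvSeq_reverse, ← ZMod.natCast_eq_zero_iff_even] at heven
  rw [M.symmetric, ← prod_map_reverse_alternatingWord, prod_map_signedConj, hone, heven]
  simp [Function.End.one_def]

open Classical in
theorem count_leftInvSeq_congr {ω ω' : List B} (h : cs.wordProd ω = cs.wordProd ω') (t : W) :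
    ((cs.leftInvSeq ω).count t : ZMod 2) = (cs.leftInvSeq ω').count t := by
  have prod_eq_lift (ω : List B) : (ω.reverse.map (signedConj cs)).prod =
      cs.lift ⟨signedConj cs, isLiftable_signedConj cs⟩ (cs.wordProd ω)⁻¹ := by
    rw [← wordProd_reverse, wordProd, map_list_prod, List.map_map]
    congr 2
    funext i
    exact (cs.lift_apply_simple (isLiftable_signedConj cs) i).symm
  have hω := congrFun (prod_eq_lift ω) (t, 0)
  rw [h, ← congrFun (prod_eq_lift ω') (t, 0), prod_map_signedConj, prod_map_signedConj] at hω
  simpa [rightInvSeq_reverse] using (Prod.ext_iff.1 hω).2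

theorem exists_eraseIdx_of_isLeftDescent {ω : List B} {i : B}
    (h : cs.IsLeftDescent (cs.wordProd ω) i) :
    ∃ j < ω.length, cs.simple i * cs.wordProd ω = cs.wordProd (ω.eraseIdx j) := by
  classical
  obtain ⟨ω', hω', hw⟩ := cs.exists_isReduced (cs.simple i * cs.wordProd ω)
  have hcons : cs.wordProd (i :: ω') = cs.wordProd ω := by
    rw [wordProd_cons, ← hw, simple_mul_simple_cancel_left]
  have hnotMem : cs.simple i ∉ cs.leftInvSeq ω' := by
    intro hmem
    have hlt := (cs.isLeftInversion_of_mem_leftInvSeq hω' hmem).2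
    rw [← hw, simple_mul_simple_cancel_left] at hlt
    exact lt_asymm h hlt
  have hnotMemConj : cs.simple i ∉ (cs.leftInvSeq ω').map (MulAut.conj (cs.simple i)) := by
    intro hmem
    obtain ⟨t, ht, hti⟩ := List.mem_map.1 hmem
    rw [MulAut.conj_apply, mul_inv_eq_iff_eq_mul, mul_right_inj] at hti
    exact hnotMem (hti ▸ ht)
  have hcount := count_leftInvSeq_congr cs hcons (cs.simple i)
  rw [leftInvSeq, List.count_cons_self, List.count_eq_zero_of_not_mem hnotMemConj] at hcount
  have hmem : cs.simple i ∈ cs.leftInvSeq ω := by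
    by_contra hnot
    simp [List.count_eq_zero_of_not_mem hnot] at hcount
  obtain ⟨j, hj, hji⟩ := List.mem_iff_getElem.1 hmem
  refine ⟨j, by simpa using hj, ?_⟩
  rw [← getD_leftInvSeq_mul_wordProd, List.getD_eq_getElem _ _ hj, hji]

end Exchange

section Parabolic

open CoxeterSystem

variable {B : Type*} {M : CoxeterMatrix B} {W : Type*} [Group W] (cs : CoxeterSystem M W)

theorem isReduced_cons_iff {i : B} {ω : List B} :
    cs.IsReduced (i :: ω) ↔ cs.IsReduced ω ∧ ¬ cs.IsLeftDescent (cs.wordProd ω) i := by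
  refine ⟨fun h => ?_, fun ⟨hω, hi⟩ => ?_⟩
  · have hω : cs.IsReduced ω := by simpa using h.drop 1
    refine ⟨hω, cs.not_isLeftDescent_iff.2 ?_⟩
    rw [← wordProd_cons, h.eq, hω.eq, List.length_cons]
  · rw [CoxeterSystem.IsReduced, wordProd_cons, cs.not_isLeftDescent_iff.1 hi, hω.eq,
      List.length_cons]

theorem isLeftDescent_of_mul {u v : W} {i : B} (h : cs.IsLeftDescent (u * v) i) :
    cs.IsLeftDescent u i ∨
      ∃ v', cs.length v' < cs.length v ∧ cs.simple i * (u * v) = u * v' := by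
  obtain ⟨ω₁, h₁, rfl⟩ := cs.exists_isReduced u
  obtain ⟨ω₂, h₂, rfl⟩ := cs.exists_isReduced v
  rw [← wordProd_append] at h
  obtain ⟨j, hj, herase⟩ := exists_eraseIdx_of_isLeftDescent cs h
  rcases lt_or_ge j ω₁.length with hj₁ | hj₁
  · left
    rw [List.eraseIdx_append_of_lt_length hj₁, wordProd_append, wordProd_append, ← mul_assoc,
      mul_left_inj] at herase
    rw [IsLeftDescent, herase, h₁.eq]
    refine (cs.length_wordProd_le _).trans_lt ?_
    rw [List.length_eraseIdx_of_lt hj₁]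
    lia
  · right
    rw [List.eraseIdx_append_of_length_le hj₁, wordProd_append, wordProd_append] at herase
    refine ⟨_, ?_, herase⟩
    rw [List.length_append] at hj
    rw [h₂.eq]
    refine (cs.length_wordProd_le _).trans_lt ?_
    rw [List.length_eraseIdx_of_lt (by lia)]
    lia

theorem length_eq_add_of_forall_isLeftDescent {w : W} (hw : ∀ i, cs.IsLeftDescent w i) (x : W) :
    cs.length w = cs.length x + cs.length (x⁻¹ * w) := by
  obtain ⟨ω, hω, rfl⟩ := cs.exists_isReduced x
  induction ω with
  | nil => simp
  | cons i ω ih =>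
    obtain ⟨hred, hi⟩ := (isReduced_cons_iff cs).1 hω
    have hadd := ih hred
    set u := cs.wordProd ω
    have hdesc : cs.IsLeftDescent (u * (u⁻¹ * w)) i := by simpa using hw i
    obtain ⟨v', hv', hmul⟩ := (isLeftDescent_of_mul cs hdesc).resolve_left hi
    obtain rfl : v' = (cs.simple i * u)⁻¹ * w := by
      rw [mul_inv_cancel_left] at hmul
      rw [mul_inv_rev, inv_simple, mul_assoc, hmul, inv_mul_cancel_left]
    have hle := cs.length_mul_le (cs.simple i * u) ((cs.simple i * u)⁻¹ * w)
    rw [mul_inv_cancel_left, cs.not_isLeftDescent_iff.1 hi] at hle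
    rw [wordProd_cons, cs.not_isLeftDescent_iff.1 hi]
    lia

/-- The standard parabolic subgroup `W_I`, for a Coxeter system of any rank. -/
def standardParabolic (I : Set B) : Subgroup W := Subgroup.closure (cs.simple '' I)

theorem simple_mem_standardParabolic {I : Set B} {i : B} (hi : i ∈ I) :
    cs.simple i ∈ standardParabolic cs I := Subgroup.subset_closure ⟨i, hi, rfl⟩

theorem standardParabolic_mono {I J : Set B} (h : I ⊆ J) :
    standardParabolic cs I ≤ standardParabolic cs J :=
  Subgroup.closure_mono (Set.image_mono h)

theorem wordProd_mem_standardParabolic {I : Set B} {ω : List B} (hω : ∀ i ∈ ω, i ∈ I) :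
    cs.wordProd ω ∈ standardParabolic cs I :=
  list_prod_mem fun _ hx => by
    obtain ⟨i, hi, rfl⟩ := List.mem_map.1 hx
    exact simple_mem_standardParabolic cs (hω i hi)

theorem exists_isReduced_of_mem_standardParabolic {I : Set B} {x : W}
    (hx : x ∈ standardParabolic cs I) :
    ∃ ω : List B, (∀ i ∈ ω, i ∈ I) ∧ cs.IsReduced ω ∧ x = cs.wordProd ω := by
  have simple_mul {i : B} (hi : i ∈ I) {ω : List B} (hI : ∀ i ∈ ω, i ∈ I)
      (hω : cs.IsReduced ω) : ∃ ω' : List B, (∀ i ∈ ω', i ∈ I) ∧ cs.IsReduced ω' ∧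
        cs.simple i * cs.wordProd ω = cs.wordProd ω' := by
    by_cases hd : cs.IsLeftDescent (cs.wordProd ω) i
    · obtain ⟨j, hj, herase⟩ := exists_eraseIdx_of_isLeftDescent cs hd
      refine ⟨ω.eraseIdx j, fun k hk => hI k (List.mem_of_mem_eraseIdx hk), ?_, herase⟩
      rw [cs.isLeftDescent_iff, hω.eq] at hd
      rw [CoxeterSystem.IsReduced, ← herase, List.length_eraseIdx_of_lt hj]
      lia
    · exact ⟨i :: ω, by simpa using ⟨hi, hI⟩, (isReduced_cons_iff cs).2 ⟨hω, hd⟩,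
        (cs.wordProd_cons i ω).symm⟩
  induction hx using Subgroup.closure_induction_left with
  | one => exact ⟨[], by simp, by simp [CoxeterSystem.IsReduced], by simp⟩
  | mul_left _ hs _ _ ih =>
    obtain ⟨i, hi, rfl⟩ := hs
    obtain ⟨ω, hI, hω, rfl⟩ := ih
    exact simple_mul hi hI hω
  | inv_mul_cancel _ hs _ _ ih =>
    obtain ⟨i, hi, rfl⟩ := hs
    obtain ⟨ω, hI, hω, rfl⟩ := ih
    rw [inv_simple]
    exact simple_mul hi hI hω

theorem exists_isLeftDescent_of_mem_standardParabolic {I : Set B} {x : W}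
    (hx : x ∈ standardParabolic cs I) (hne : x ≠ 1) : ∃ i ∈ I, cs.IsLeftDescent x i := by
  obtain ⟨_ | ⟨i, ω⟩, hI, hω, rfl⟩ := exists_isReduced_of_mem_standardParabolic cs hx
  · simp at hne
  · refine ⟨i, hI i (by simp), ?_⟩
    have hi := ((isReduced_cons_iff cs).1 hω).2
    rwa [wordProd_cons, isLeftDescent_iff_not_isLeftDescent_mul, simple_mul_simple_cancel_left]

theorem length_mul_of_forall_length_le {I : Set B} {y : W}
    (hy : ∀ z ∈ standardParabolic cs I, cs.length y ≤ cs.length (z * y)) {x : W}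
    (hx : x ∈ standardParabolic cs I) :
    cs.length (x * y) = cs.length x + cs.length y := by
  obtain ⟨ω, hI, hω, rfl⟩ := exists_isReduced_of_mem_standardParabolic cs hx
  clear hx
  induction ω with
  | nil => simp
  | cons i ω ih =>
    obtain ⟨hred, hi⟩ := (isReduced_cons_iff cs).1 hω
    have hIω : ∀ j ∈ ω, j ∈ I := fun j hj => hI j (List.mem_cons_of_mem i hj)
    have hmem := wordProd_mem_standardParabolic cs hIω
    have hndesc : ¬ cs.IsLeftDescent (cs.wordProd ω * y) i := by
      intro hd
      obtain ⟨y', hlt, hmul⟩ := (isLeftDescent_of_mul cs hd).resolve_left hi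
      have hle := hy ((cs.wordProd ω)⁻¹ * (cs.simple i * cs.wordProd ω))
        (mul_mem (inv_mem hmem)
          (mul_mem (simple_mem_standardParabolic cs (hI i (by simp))) hmem))
      rw [mul_assoc, mul_assoc, hmul, inv_mul_cancel_left] at hle
      lia
    rw [wordProd_cons, mul_assoc, cs.not_isLeftDescent_iff.1 hndesc, ih hIω hred,
      cs.not_isLeftDescent_iff.1 hi]
    ring

/-- The minimal representatives of the cosets `W_I w`, encoded as the elements without left
descents in `I`. -/
def minimalReps (I : Set B) : Set W := {w | ∀ i ∈ I, ¬ cs.IsLeftDescent w i}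

theorem exists_mul_eq_and_forall_length_le (I : Set B) (w : W) :
    ∃ x ∈ standardParabolic cs I, ∃ y, x * y = w ∧
      ∀ z ∈ standardParabolic cs I, cs.length y ≤ cs.length (z * y) := by
  obtain ⟨z₀, hz₀, hmin⟩ := exists_minimalFor_of_wellFoundedLT (· ∈ standardParabolic cs I)
    (fun z => cs.length (z * w)) ⟨1, one_mem _⟩
  refine ⟨z₀⁻¹, inv_mem hz₀, z₀ * w, by simp, fun z hz => ?_⟩
  rw [← mul_assoc]
  exact (le_total _ _).elim id (hmin (mul_mem hz hz₀))

theorem length_le_of_mem_minimalReps {I : Set B} {y : W} (hy : y ∈ minimalReps cs I) :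
    ∀ z ∈ standardParabolic cs I, cs.length y ≤ cs.length (z * y) := by
  obtain ⟨x, hx, y, rfl, hmin⟩ := exists_mul_eq_and_forall_length_le cs I y
  rcases eq_or_ne x 1 with rfl | hne
  · simpa using hmin
  obtain ⟨i, hi, hd⟩ := exists_isLeftDescent_of_mem_standardParabolic cs hx hne
  refine absurd ?_ (hy i hi)
  rw [IsLeftDescent] at hd ⊢
  rw [← mul_assoc, length_mul_of_forall_length_le cs hmin hx, length_mul_of_forall_length_le cs hmin
    (mul_mem (simple_mem_standardParabolic cs hi) hx)]
  lia

theorem length_mul_of_mem_minimalReps {I : Set B} {x y : W}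
    (hx : x ∈ standardParabolic cs I) (hy : y ∈ minimalReps cs I) :
    cs.length (x * y) = cs.length x + cs.length y :=
  length_mul_of_forall_length_le cs (length_le_of_mem_minimalReps cs hy) hx

theorem bijOn_mul_minimalReps {I : Set B} {H : Subgroup W} (hH : standardParabolic cs I ≤ H) :
    Set.BijOn (fun p : W × W => p.1 * p.2)
      ((standardParabolic cs I : Set W) ×ˢ ((H : Set W) ∩ minimalReps cs I)) H := by
  refine ⟨fun p hp => mul_mem (hH hp.1) hp.2.1, ?_, fun w hw => ?_⟩
  · rintro ⟨x, y⟩ ⟨hx, -, hy⟩ ⟨x', y'⟩ ⟨hx', -, hy'⟩ (h : x * y = x' * y')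
    have hz : x'⁻¹ * x ∈ standardParabolic cs I := mul_mem (inv_mem hx') hx
    have hyz : x'⁻¹ * x * y = y' := by rw [mul_assoc, h, inv_mul_cancel_left]
    have hadd := length_mul_of_mem_minimalReps cs hz hy
    have hle := length_le_of_mem_minimalReps cs hy' _ (inv_mem hz)
    rw [← hyz, inv_mul_cancel_left] at hle
    have hone : x'⁻¹ * x = 1 := by rw [← cs.length_eq_zero_iff]; lia
    rw [hone, one_mul] at hyz
    rw [Prod.mk.injEq]
    exact ⟨(inv_mul_eq_one.1 hone).symm, hyz⟩
  · obtain ⟨x, hx, y, rfl, hmin⟩ := exists_mul_eq_and_forall_length_le cs I w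
    refine ⟨(x, y), ⟨hx, (mul_mem_cancel_left (hH hx)).1 hw, fun i hi hd => ?_⟩, rfl⟩
    exact (hmin _ (simple_mem_standardParabolic cs hi)).not_gt hd

end Parabolic

section Alternating

/-- The alternating product `x * y * x * ⋯` with `n` factors, starting with `x`. -/
def altProd {G : Type*} [Monoid G] (x y : G) : ℕ → G
  | 0 => 1
  | n + 1 => x * altProd y x n

theorem altProd_zero {G : Type*} [Monoid G] (x y : G) : altProd x y 0 = 1 := rfl

theorem altProd_succ {G : Type*} [Monoid G] (x y : G) (n : ℕ) :
    altProd x y (n + 1) = x * altProd y x n := rfl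

theorem altProd_add {G : Type*} [Monoid G] (x y : G) (m n : ℕ) :
    altProd x y (m + n) = altProd x y m * if Even m then altProd x y n else altProd y x n := by
  induction m generalizing x y with
  | zero => simp [altProd_zero]
  | succ m ih =>
    rw [Nat.add_right_comm, altProd_succ, altProd_succ, ih, mul_assoc]
    simp only [Nat.even_add_one, ite_not]

/-- The sum of the alternating products with fewer than `m` factors, starting with `x`: the
Poincaré polynomial of the minimal representatives of a rank one subgroup in a dihedral group. -/
def altSum {R : Type*} [Ring R] (x y : R) (m : ℕ) : R := ∑ n ∈ Finset.range m, altProd x y n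

theorem one_add_mul_altSum {R : Type*} [Ring R] (x y : R) (m : ℕ) :
    (1 + x) * altSum y x m = altSum y x m + altSum x y m + altProd x y m - 1 := by
  have hshift : x * altSum y x m + 1 = altSum x y m + altProd x y m := by
    rw [altSum, altSum, ← Finset.sum_range_succ, Finset.sum_range_succ', Finset.mul_sum]
    simp only [altProd_succ, altProd_zero]
  rw [add_mul, one_mul, eq_sub_iff_add_eq, add_assoc, hshift, add_assoc]

end Alternating

section Dihedral

open CoxeterSystem

variable {B : Type*} {M : CoxeterMatrix B} {W : Type*} [Group W] (cs : CoxeterSystem M W) {i j : B}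

theorem wordProd_alternatingWord (i j : B) (n : ℕ) :
    cs.wordProd (alternatingWord i j n) = if Even n then altProd (cs.simple i) (cs.simple j) n
      else altProd (cs.simple j) (cs.simple i) n := by
  induction n with
  | zero => simp [alternatingWord, altProd_zero]
  | succ n ih =>
    rw [alternatingWord_succ', wordProd_cons, ih, altProd_succ, altProd_succ]
    by_cases hn : Even n <;> simp [hn, Nat.even_add_one]

theorem altProd_simple_comm (i j : B) :
    altProd (cs.simple i) (cs.simple j) (M i j) = altProd (cs.simple j) (cs.simple i) (M i j) := by
  have h := cs.wordProd_braidWord_eq i j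
  rw [braidWord, braidWord, wordProd_alternatingWord, wordProd_alternatingWord,
    M.symmetric j i] at h
  split_ifs at h
  exacts [h, h.symm]

theorem altProd_simple_mem (i j : B) (n : ℕ) :
    altProd (cs.simple i) (cs.simple j) n ∈ standardParabolic cs {i, j} := by
  induction n generalizing i j with
  | zero => exact one_mem _
  | succ n ih =>
    exact mul_mem (simple_mem_standardParabolic cs (by simp)) (Set.pair_comm i j ▸ ih j i)

theorem length_altProd_simple_le (i j : B) (n : ℕ) :
    cs.length (altProd (cs.simple i) (cs.simple j) n) ≤ n := by
  induction n generalizing i j with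
  | zero => simp [altProd_zero]
  | succ n ih =>
    have hle := cs.length_mul_le (cs.simple i) (altProd (cs.simple j) (cs.simple i) n)
    rw [cs.length_simple] at hle
    rw [altProd_succ]
    have := ih j i
    lia

theorem length_altProd_of_le
    (hm : cs.length (altProd (cs.simple i) (cs.simple j) (M i j)) = M i j)
    {n : ℕ} (hn : n ≤ M i j) :
    cs.length (altProd (cs.simple i) (cs.simple j) n) = n ∧
      cs.length (altProd (cs.simple j) (cs.simple i) n) = n := by
  have length_tail {i j : B} {n : ℕ}
      (h : cs.length (altProd (cs.simple i) (cs.simple j) (n + 1)) = n + 1) :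
      cs.length (altProd (cs.simple j) (cs.simple i) n) = n := by
    have hle := cs.length_mul_le (cs.simple i) (altProd (cs.simple j) (cs.simple i) n)
    rw [← altProd_succ, h, cs.length_simple] at hle
    have := length_altProd_simple_le cs j i n
    lia
  induction hn using Nat.decreasingInduction with
  | self => exact ⟨hm, altProd_simple_comm cs i j ▸ hm⟩
  | of_succ n _ ih => exact ⟨length_tail ih.2, length_tail ih.1⟩

theorem eq_altProd_of_not_isLeftDescent {x : W} (hx : x ∈ standardParabolic cs {i, j})
    (hi : ¬ cs.IsLeftDescent x i) :
    x = altProd (cs.simple j) (cs.simple i) (cs.length x) := by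
  induction hn : cs.length x generalizing x i j with
  | zero => exact cs.length_eq_zero_iff.1 hn
  | succ n ih =>
    have hne : x ≠ 1 := by rintro rfl; simp at hn
    obtain ⟨k, hk, hd⟩ := exists_isLeftDescent_of_mem_standardParabolic cs hx hne
    obtain rfl : k = j := hk.resolve_left (by rintro rfl; exact hi hd)
    have hmem : cs.simple k * x ∈ standardParabolic cs {k, i} :=
      mul_mem (simple_mem_standardParabolic cs (by simp)) (Set.pair_comm i k ▸ hx)
    have htail := ih hmem (cs.isLeftDescent_iff_not_isLeftDescent_mul.1 hd)
      (by have := cs.isLeftDescent_iff.1 hd; lia)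
    rw [altProd_succ, ← htail, simple_mul_simple_cancel_left]

theorem isLeftDescent_altProd_of_le {n : ℕ} (hM : M i j ≠ 0) (hn : M i j ≤ n)
    (hlen : cs.length (altProd (cs.simple j) (cs.simple i) n) = n) :
    cs.IsLeftDescent (altProd (cs.simple j) (cs.simple i) n) i := by
  obtain ⟨k, rfl⟩ := Nat.exists_eq_add_of_le hn
  obtain ⟨m, hm⟩ := Nat.exists_eq_succ_of_ne_zero hM
  rw [IsLeftDescent, hlen, altProd_add, ← altProd_simple_comm]
  set z := if Even (M i j) then altProd (cs.simple j) (cs.simple i) k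
    else altProd (cs.simple i) (cs.simple j) k
  have hz : cs.length z ≤ k := by
    unfold z
    split_ifs <;> exact length_altProd_simple_le cs _ _ k
  have hle := cs.length_mul_le (altProd (cs.simple j) (cs.simple i) m) z
  have hprefix := length_altProd_simple_le cs j i m
  rw [hm, altProd_succ, mul_assoc, simple_mul_simple_cancel_left]
  lia

theorem standardParabolic_inter_minimalReps
    (hM : M i j ≠ 0) (hm : cs.length (altProd (cs.simple i) (cs.simple j) (M i j)) = M i j) :
    (standardParabolic cs {i, j} : Set W) ∩ minimalReps cs {i} =
      altProd (cs.simple j) (cs.simple i) '' Set.Iio (M i j) := by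
  ext x
  constructor
  · rintro ⟨hx, hmin⟩
    have hi : ¬ cs.IsLeftDescent x i := hmin i rfl
    have hx_eq := eq_altProd_of_not_isLeftDescent cs hx hi
    refine ⟨cs.length x, Set.mem_Iio.2 (lt_of_not_ge fun hle => hi ?_), hx_eq.symm⟩
    rw [hx_eq]
    exact isLeftDescent_altProd_of_le cs hM hle (by rw [← hx_eq])
  · rintro ⟨n, hn : n < M i j, rfl⟩
    refine ⟨Set.pair_comm i j ▸ altProd_simple_mem cs j i n, ?_⟩
    rintro _ rfl
    rw [cs.not_isLeftDescent_iff, ← altProd_succ, (length_altProd_of_le cs hm hn).1,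
      (length_altProd_of_le cs hm hn.le).2]

end Dihedral

section Straight

open CoxeterSystem

variable {B : Type*} {M : CoxeterMatrix B} {W : Type*} [Group W] (cs : CoxeterSystem M W)

/-- A straight word: all its powers are reduced. -/
def IsStraightWord (ω : List B) : Prop := ∀ n, cs.IsReduced (List.replicate n ω).flatten

variable {cs} {ω : List B}

theorem wordProd_flatten_replicate (ω : List B) (n : ℕ) :
    cs.wordProd (List.replicate n ω).flatten = cs.wordProd ω ^ n := by
  induction n with
  | zero => simp
  | succ n ih =>
    rw [List.replicate_succ, List.flatten_cons, wordProd_append, ih, pow_succ']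

theorem IsStraightWord.isReduced (h : IsStraightWord cs ω) : cs.IsReduced ω := by
  simpa using h 1

theorem IsStraightWord.length_pow (h : IsStraightWord cs ω) (n : ℕ) :
    cs.length (cs.wordProd ω ^ n) = n * ω.length := by
  rw [← wordProd_flatten_replicate, (h n).eq]
  simp

end Straight

section LengthModel

open CoxeterSystem

variable {B : Type*} {M : CoxeterMatrix B} {W : Type*} [Group W] (cs : CoxeterSystem M W)
  {X : Type*}

/-- An action of the Coxeter group of `M` on a set `X` with a height function that each simple
reflection raises by at most one: heights in the orbit of the base point bound lengths from
below. -/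
structure LengthModel (M : CoxeterMatrix B) (X : Type*) where
  act : B → X → X
  iterate_act : ∀ i j x, (act i ∘ act j)^[M i j] x = x
  height : X → ℕ
  base : X
  height_base : height base = 0
  height_act_le : ∀ i x, height (act i x) ≤ height x + 1

namespace LengthModel

variable (m : LengthModel M X) {ω : List B}

theorem isLiftable_act : M.IsLiftable (G := Function.End X) m.act := fun i j =>
  (hom_coe_pow (fun g : Function.End X => g) rfl (fun _ _ => rfl) _ _).trans
    (funext (m.iterate_act i j))

theorem foldr_act_eq_lift (ω : List B) (x : X) :
    ω.foldr m.act x = cs.lift ⟨_, m.isLiftable_act⟩ (cs.wordProd ω) • x := by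
  induction ω with
  | nil => rw [wordProd_nil, map_one, one_smul, List.foldr_nil]
  | cons i ω ih =>
    rw [List.foldr_cons, ih, wordProd_cons, map_mul, mul_smul]
    exact (congrFun (cs.lift_apply_simple m.isLiftable_act i) _).symm

theorem height_foldr_act_le_length (ω : List B) :
    m.height (ω.foldr m.act m.base) ≤ cs.length (cs.wordProd ω) := by
  obtain ⟨ω', hω', h⟩ := cs.exists_isReduced (cs.wordProd ω)
  have height_le : ∀ ω : List B, m.height (ω.foldr m.act m.base) ≤ ω.length := by
    intro ω
    induction ω with
    | nil => exact m.height_base.le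
    | cons i ω ih => exact (m.height_act_le i _).trans (Nat.succ_le_succ ih)
  rw [m.foldr_act_eq_lift cs, h, ← m.foldr_act_eq_lift cs, hω'.eq]
  exact height_le ω'

theorem isReduced_of_length_le (h : ω.length ≤ m.height (ω.foldr m.act m.base)) :
    cs.IsReduced ω :=
  le_antisymm (cs.length_wordProd_le ω) (h.trans (m.height_foldr_act_le_length cs ω))

theorem isStraightWord_of_invariant (C : Set X) (hbase : m.base ∈ C)
    (hC : ∀ x ∈ C, ω.foldr m.act x ∈ C ∧
      m.height (ω.foldr m.act x) = m.height x + ω.length) :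
    IsStraightWord cs ω := by
  intro n
  apply m.isReduced_of_length_le
  suffices h : (List.replicate n ω).flatten.foldr m.act m.base ∈ C ∧
      m.height ((List.replicate n ω).flatten.foldr m.act m.base) = n * ω.length by
    rw [h.2]
    simp
  induction n with
  | zero => exact ⟨hbase, by simpa using m.height_base⟩
  | succ n ih =>
    rw [List.replicate_succ, List.flatten_cons, List.foldr_append]
    refine ⟨(hC _ ih.1).1, ?_⟩
    rw [(hC _ ih.1).2, ih.2]
    ring

end LengthModel

end LengthModel

section Alcoves

/-- The alcoves of type `Ã₂`, encoded by the integer parts of the positive roots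
`α₁, α₂, α₁ + α₂`; the height is the number of hyperplanes that separate an alcove from the
fundamental one. -/
def alcoveModelA2 : LengthModel AffineType.A2.coxeterMatrix (ℤ × ℤ × ℤ) where
  act
    | 0 => fun (x, y, z) => (-x - 1, z, y)
    | 1 => fun (x, y, z) => (z, -y - 1, x)
    | 2 => fun (x, y, z) => (-y, -x, 1 - z)
  iterate_act := by
    rintro i j ⟨x, y, z⟩
    fin_cases i <;> fin_cases j <;> simp [AffineType.coxeterMatrix]
  height := fun (x, y, z) => x.natAbs + y.natAbs + z.natAbs
  base := 0
  height_base := rfl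
  height_act_le := by
    rintro i ⟨x, y, z⟩
    fin_cases i <;> dsimp only <;> lia

/-- The alcoves of type `C̃₂`, encoded by the integer parts of the two long and the two short
positive roots; the height is the number of separating hyperplanes. -/
def alcoveModelC2 : LengthModel AffineType.C2.coxeterMatrix (ℤ × ℤ × ℤ × ℤ) where
  act
    | 0 => fun (x, y, p, r) => (y, x, -p - 1, r)
    | 1 => fun (x, y, p, r) => (x, -y - 1, r, p)
    | 2 => fun (x, y, p, r) => (1 - x, y, -r, -p)
  iterate_act := by
    rintro i j ⟨x, y, p, r⟩
    fin_cases i <;> fin_cases j <;> simp [AffineType.coxeterMatrix]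
  height := fun (x, y, p, r) => x.natAbs + y.natAbs + p.natAbs + r.natAbs
  base := 0
  height_base := rfl
  height_act_le := by
    rintro i ⟨x, y, p, r⟩
    fin_cases i <;> dsimp only <;> lia

/-- The alcoves of type `G̃₂`, encoded by the integer parts of the positive roots
`α₂, α₁, α₁ + α₂, α₁ + 2α₂, α₁ + 3α₂, 2α₁ + 3α₂`, with `α₁` long; the height is the number of
separating hyperplanes. -/
def alcoveModelG2 : LengthModel AffineType.G2.coxeterMatrix (ℤ × ℤ × ℤ × ℤ × ℤ × ℤ) where
  act
    | 0 => fun (x, y, p, r, s, t) => (p, -y - 1, x, r, t, s)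
    | 1 => fun (x, y, p, r, s, t) => (-x - 1, s, r, p, y, t)
    | 2 => fun (x, y, p, r, s, t) => (x, -s, -r, -p, -y, 1 - t)
  iterate_act := by
    rintro i j ⟨x, y, p, r, s, t⟩
    fin_cases i <;> fin_cases j <;> simp [AffineType.coxeterMatrix]
  height := fun (x, y, p, r, s, t) =>
    x.natAbs + y.natAbs + p.natAbs + r.natAbs + s.natAbs + t.natAbs
  base := 0
  height_base := rfl
  height_act_le := by
    rintro i ⟨x, y, p, r, s, t⟩
    fin_cases i <;> dsimp only <;> lia

end Alcoves

namespace AffineType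

variable {W : Type*} [Group W] (T : AffineType) (cs : CoxeterSystem T.coxeterMatrix W)

theorem isReduced_braidWord (i j : Fin 3) :
    cs.IsReduced (CoxeterSystem.braidWord T.coxeterMatrix i j) := by
  cases T
  · refine alcoveModelA2.isReduced_of_length_le cs ?_
    revert i j
    decide
  · refine alcoveModelC2.isReduced_of_length_le cs ?_
    revert i j
    decide
  · refine alcoveModelG2.isReduced_of_length_le cs ?_
    revert i j
    decide

theorem length_altProd_simple (i j : Fin 3) :
    cs.length (altProd (cs.simple i) (cs.simple j) (T.coxeterMatrix i j)) =
      T.coxeterMatrix i j := by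
  have h := (T.isReduced_braidWord cs i j).eq
  rw [CoxeterSystem.braidWord, wordProd_alternatingWord, ← altProd_simple_comm, ite_self,
    CoxeterSystem.length_alternatingWord] at h
  exact h

theorem coxeterMatrix_ne_zero (i j : Fin 3) : T.coxeterMatrix i j ≠ 0 := by
  cases T <;> fin_cases i <;> fin_cases j <;> simp [coxeterMatrix]

/-- The defining word of the strip element `w₁`. -/
def stripWord₁ : AffineType → List (Fin 3)
  | .A2 => [2, 1, 0]
  | .C2 => [2, 0, 1, 0]
  | .G2 => [2, 0, 1]

/-- The defining word of the strip element `w₂`. -/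
def stripWord₂ : AffineType → List (Fin 3)
  | .A2 => [2, 0, 1]
  | .C2 => [2, 0, 1]
  | .G2 => [2, 0, 1, 0, 1]

theorem wordProd_stripWord₁ : cs.wordProd T.stripWord₁ = stripElement₁ T cs := by
  cases T <;> simp [stripWord₁, stripElement₁, CoxeterSystem.wordProd, mul_assoc]

theorem wordProd_stripWord₂ : cs.wordProd T.stripWord₂ = stripElement₂ T cs := by
  cases T <;> simp [stripWord₂, stripElement₂, CoxeterSystem.wordProd, mul_assoc]

/-- In each type the invariant set lies in a strip `0 < α < 1`, the root `α` being the coordinate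
set to `0`: translation along the strip crosses a new hyperplane at every letter. -/
theorem isStraightWord_stripWord₁ : IsStraightWord cs T.stripWord₁ := by
  cases T
  · refine alcoveModelA2.isStraightWord_of_invariant cs {(x, y, z) | 0 ≤ x ∧ y = 0 ∧ 0 ≤ z}
      (by simp [alcoveModelA2]) ?_
    rintro ⟨x, y, z⟩ h
    simp only [stripWord₁, alcoveModelA2, List.foldr, List.length, Set.mem_ofPred_eq] at *
    lia
  · refine alcoveModelC2.isStraightWord_of_invariant cs
      {(x, y, p, r) | 0 ≤ x ∧ y = 0 ∧ 0 ≤ p ∧ 0 ≤ r} (by simp [alcoveModelC2]) ?_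
    rintro ⟨x, y, p, r⟩ h
    simp only [stripWord₁, alcoveModelC2, List.foldr, List.length, Set.mem_ofPred_eq] at *
    lia
  · refine alcoveModelG2.isStraightWord_of_invariant cs
      {(x, y, p, r, s, t) | 0 ≤ x ∧ y ≤ 0 ∧ p = 0 ∧ 0 ≤ r ∧ 0 ≤ s ∧ 0 ≤ t}
      (by simp [alcoveModelG2]) ?_
    rintro ⟨x, y, p, r, s, t⟩ h
    simp only [stripWord₁, alcoveModelG2, List.foldr, List.length, Set.mem_ofPred_eq] at *
    lia

theorem isStraightWord_stripWord₂ : IsStraightWord cs T.stripWord₂ := by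
  cases T
  · refine alcoveModelA2.isStraightWord_of_invariant cs {(x, y, z) | x = 0 ∧ 0 ≤ y ∧ 0 ≤ z}
      (by simp [alcoveModelA2]) ?_
    rintro ⟨x, y, z⟩ h
    simp only [stripWord₂, alcoveModelA2, List.foldr, List.length, Set.mem_ofPred_eq] at *
    lia
  · refine alcoveModelC2.isStraightWord_of_invariant cs
      {(x, y, p, r) | 0 ≤ x ∧ 0 ≤ y ∧ p = 0 ∧ 0 ≤ r} (by simp [alcoveModelC2]) ?_
    rintro ⟨x, y, p, r⟩ h
    simp only [stripWord₂, alcoveModelC2, List.foldr, List.length, Set.mem_ofPred_eq] at *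
    lia
  · refine alcoveModelG2.isStraightWord_of_invariant cs
      {(x, y, p, r, s, t) | 0 ≤ x ∧ y = 0 ∧ 0 ≤ p ∧ 0 ≤ r ∧ 0 ≤ s ∧ 0 ≤ t}
      (by simp [alcoveModelG2]) ?_
    rintro ⟨x, y, p, r, s, t⟩ h
    simp only [stripWord₂, alcoveModelG2, List.foldr, List.length, Set.mem_ofPred_eq] at *
    lia

theorem stripWord₁_ne_nil : T.stripWord₁ ≠ [] := by cases T <;> simp [stripWord₁]

theorem stripWord₂_ne_nil : T.stripWord₂ ≠ [] := by cases T <;> simp [stripWord₂]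

end AffineType

section Series

variable {B : Type*} {M : CoxeterMatrix B} {W : Type*} [Group W] {k : Type*} [Field k]
  (cs : CoxeterSystem M W) {q : k} {V : Type*} [AddCommGroup V] [Module k V]
  (ρ : HeckeAlgebra cs q →ₐ[k] Module.End k V)

theorem HeckeAlgebra.e_one : HeckeAlgebra.e cs q 1 = 1 :=
  (RingQuot.mkAlgHom_rel k (HeckeRel.one (cs := cs) (q := q))).trans (map_one _)

theorem HeckeAlgebra.e_mul {w v : W} (h : cs.length (w * v) = cs.length w + cs.length v) :
    HeckeAlgebra.e cs q (w * v) = HeckeAlgebra.e cs q w * HeckeAlgebra.e cs q v :=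
  ((map_mul _ _ _).symm.trans (RingQuot.mkAlgHom_rel k (HeckeRel.mul w v h))).symm

/-- The term `ρ(e_w) u^{ℓ(w)}` of the twisted Poincaré series. -/
noncomputable def heckeTerm (w : W) : PowerSeries (Module.End k V) :=
  monomial (cs.length w) (ρ (HeckeAlgebra.e cs q w))

theorem heckeTerm_one : heckeTerm cs ρ 1 = 1 := by
  rw [heckeTerm, HeckeAlgebra.e_one, cs.length_one, map_one]
  exact monomial_zero_eq_C_apply _

theorem heckeTerm_mul {w v : W} (h : cs.length (w * v) = cs.length w + cs.length v) :
    heckeTerm cs ρ (w * v) = heckeTerm cs ρ w * heckeTerm cs ρ v := by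
  rw [heckeTerm, HeckeAlgebra.e_mul cs h, h, map_mul, heckeTerm, heckeTerm, monomial_mul_monomial]

theorem heckeTerm_wordProd {ω : List B} (hω : cs.IsReduced ω) :
    heckeTerm cs ρ (cs.wordProd ω) = (ω.map fun i => heckeTerm cs ρ (cs.simple i)).prod := by
  induction ω with
  | nil => simpa using heckeTerm_one cs ρ
  | cons i ω ih =>
    obtain ⟨hred, hi⟩ := (isReduced_cons_iff cs).1 hω
    rw [cs.wordProd_cons, heckeTerm_mul, ih hred, List.map_cons, List.prod_cons]
    rw [cs.not_isLeftDescent_iff.1 hi, cs.length_simple, add_comm]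

theorem heckeTerm_altProd {i j : B}
    (hm : cs.length (altProd (cs.simple i) (cs.simple j) (M i j)) = M i j) {n : ℕ}
    (hn : n ≤ M i j) :
    heckeTerm cs ρ (altProd (cs.simple j) (cs.simple i) n) =
      altProd (heckeTerm cs ρ (cs.simple j)) (heckeTerm cs ρ (cs.simple i)) n := by
  suffices h : ∀ n ≤ M i j,
      heckeTerm cs ρ (altProd (cs.simple i) (cs.simple j) n) =
        altProd (heckeTerm cs ρ (cs.simple i)) (heckeTerm cs ρ (cs.simple j)) n ∧
      heckeTerm cs ρ (altProd (cs.simple j) (cs.simple i) n) =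
        altProd (heckeTerm cs ρ (cs.simple j)) (heckeTerm cs ρ (cs.simple i)) n from
    (h n hn).2
  clear hn n
  intro n hn
  induction n with
  | zero => exact ⟨heckeTerm_one cs ρ, heckeTerm_one cs ρ⟩
  | succ n ih =>
    obtain ⟨hi, hj⟩ := ih (by lia)
    have hlen := length_altProd_of_le cs hm hn
    have hlen' := length_altProd_of_le cs hm (Nat.le_of_succ_le hn)
    simp only [altProd_succ] at hlen ⊢
    rw [← hi, ← hj]
    constructor <;> apply heckeTerm_mul
    · rw [hlen.1, hlen'.2, cs.length_simple, add_comm]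
    · rw [hlen.2, hlen'.1, cs.length_simple, add_comm]

variable [Finite B]

open Classical in
theorem coeff_twistedPoincare (D : Set W) (n : ℕ) :
    coeff n (twistedPoincare cs ρ D) = ∑ w ∈ (cs.finite_length_eq Set.univ n).toFinset,
      if w ∈ D then ρ (HeckeAlgebra.e cs q w) else 0 := by
  rw [twistedPoincare, coeff_mk, ← Finset.sum_filter]
  congr 1
  ext w
  simp [and_comm]

theorem twistedPoincare_union {D₁ D₂ : Set W} (h : Disjoint D₁ D₂) :
    twistedPoincare cs ρ (D₁ ∪ D₂) = twistedPoincare cs ρ D₁ + twistedPoincare cs ρ D₂ := by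
  classical
  ext1 n
  rw [map_add, coeff_twistedPoincare, coeff_twistedPoincare, coeff_twistedPoincare,
    ← Finset.sum_add_distrib]
  refine Finset.sum_congr rfl fun w _ => ?_
  by_cases h₁ : w ∈ D₁
  · simp [h₁, Set.disjoint_left.1 h h₁]
  · simp [h₁]

theorem twistedPoincare_empty : twistedPoincare cs ρ ∅ = 0 := by
  ext1 n
  simp [coeff_twistedPoincare]

theorem twistedPoincare_singleton (w : W) : twistedPoincare cs ρ {w} = heckeTerm cs ρ w := by
  classical
  ext1 n
  simp [coeff_twistedPoincare, heckeTerm, coeff_monomial, eq_comm]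

theorem twistedPoincare_image {ι : Type*} (s : Finset ι) {g : ι → W}
    (hg : Set.InjOn g s) :
    twistedPoincare cs ρ (g '' s) = ∑ x ∈ s, heckeTerm cs ρ (g x) := by
  classical
  induction s using Finset.induction with
  | empty => simp [twistedPoincare_empty]
  | insert x s hx ih =>
    rw [Finset.coe_insert, Set.injOn_insert (by simpa using hx)] at hg
    rw [Finset.sum_insert hx, ← ih hg.1, ← twistedPoincare_singleton, ← twistedPoincare_union _ _
      (Set.disjoint_singleton_left.2 hg.2), Finset.coe_insert, Set.image_insert_eq,
      Set.singleton_union]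

theorem twistedPoincare_mul {D₁ D₂ D : Set W}
    (hD : Set.BijOn (fun p : W × W => p.1 * p.2) (D₁ ×ˢ D₂) D)
    (hl : ∀ x ∈ D₁, ∀ y ∈ D₂, cs.length (x * y) = cs.length x + cs.length y) :
    twistedPoincare cs ρ D = twistedPoincare cs ρ D₁ * twistedPoincare cs ρ D₂ := by
  ext1 n
  rw [PowerSeries.coeff_mul]
  simp only [twistedPoincare, coeff_mk, Finset.sum_mul_sum, ← Finset.sum_product']
  rw [Finset.sum_sigma']
  symm
  refine Finset.sum_nbij (fun x => x.2.1 * x.2.2) ?_ ?_ ?_ ?_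
  · rintro ⟨⟨i, j⟩, x, y⟩ h
    simp only [Finset.mem_sigma, Finset.mem_product, Set.Finite.mem_toFinset,
      Set.mem_ofPred_eq] at h ⊢
    obtain ⟨hij, ⟨hx, rfl⟩, hy, rfl⟩ := h
    exact ⟨hD.mapsTo (Set.mk_mem_prod hx hy),
      (hl x hx y hy).trans (Finset.HasAntidiagonal.mem_antidiagonal.1 hij)⟩
  · rintro ⟨⟨i, j⟩, x, y⟩ h ⟨⟨i', j'⟩, x', y'⟩ h' heq
    simp only [Finset.coe_sigma, Set.mem_sigma_iff, Finset.mem_coe, Finset.mem_product,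
      Set.Finite.mem_toFinset, Set.mem_ofPred_eq] at h h'
    obtain ⟨-, ⟨hx, rfl⟩, hy, rfl⟩ := h
    obtain ⟨-, ⟨hx', rfl⟩, hy', rfl⟩ := h'
    obtain ⟨rfl, rfl⟩ := Prod.ext_iff.1 <|
      hD.injOn (Set.mk_mem_prod hx hy) (Set.mk_mem_prod hx' hy') heq
    rfl
  · intro w hw
    simp only [Finset.mem_coe, Set.Finite.mem_toFinset, Set.mem_ofPred_eq] at hw
    obtain ⟨⟨x, y⟩, ⟨hx, hy⟩, rfl⟩ := hD.surjOn hw.1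
    refine ⟨⟨(cs.length x, cs.length y), x, y⟩, ?_, rfl⟩
    simpa [hx, hy, hl x hx y hy] using hw.2
  · rintro ⟨⟨i, j⟩, x, y⟩ h
    simp only [Finset.mem_sigma, Finset.mem_product, Set.Finite.mem_toFinset,
      Set.mem_ofPred_eq] at h
    rw [HeckeAlgebra.e_mul cs (hl x h.2.1.1 y h.2.2.1), map_mul]

theorem twistedPoincare_subgroup {I : Set B} {H : Subgroup W} (hH : standardParabolic cs I ≤ H) :
    twistedPoincare cs ρ H = twistedPoincare cs ρ (standardParabolic cs I) *
      twistedPoincare cs ρ (H ∩ minimalReps cs I) :=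
  twistedPoincare_mul cs ρ (bijOn_mul_minimalReps cs hH)
    fun _ hx _ hy => length_mul_of_mem_minimalReps cs hx hy.2

theorem twistedPoincare_standardParabolic_singleton (i : B) :
    twistedPoincare cs ρ (standardParabolic cs {i}) = 1 + heckeTerm cs ρ (cs.simple i) := by
  have hW : (standardParabolic cs {i} : Set W) = {1} ∪ {cs.simple i} := by
    ext x
    refine ⟨fun hx => ?_, ?_⟩
    · refine or_iff_not_imp_left.2 fun hne => ?_
      obtain ⟨_, rfl, hi⟩ := exists_isLeftDescent_of_mem_standardParabolic cs hx hne
      have hmem := mul_mem (simple_mem_standardParabolic cs (Set.mem_singleton _)) hx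
      by_contra hne'
      obtain ⟨_, rfl, hi'⟩ := exists_isLeftDescent_of_mem_standardParabolic cs hmem
        fun h => hne' (by simpa [mul_eq_one_iff_eq_inv', eq_comm] using h)
      exact cs.isLeftDescent_iff_not_isLeftDescent_mul.1 hi hi'
    · rintro (rfl | rfl)
      exacts [one_mem _, simple_mem_standardParabolic cs rfl]
  have hne : (1 : W) ≠ cs.simple i := fun h => by simpa using congrArg cs.length h
  rw [hW, twistedPoincare_union cs ρ (Set.disjoint_singleton.2 hne), twistedPoincare_singleton,
    twistedPoincare_singleton, heckeTerm_one]

theorem twistedPoincare_standardParabolic_pair {i j : B} (hM : M i j ≠ 0)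
    (hm : cs.length (altProd (cs.simple i) (cs.simple j) (M i j)) = M i j) :
    twistedPoincare cs ρ (standardParabolic cs {i, j}) =
      (1 + heckeTerm cs ρ (cs.simple i)) *
        altSum (heckeTerm cs ρ (cs.simple j)) (heckeTerm cs ρ (cs.simple i)) (M i j) := by
  have hinj : Set.InjOn (altProd (cs.simple j) (cs.simple i)) (Finset.range (M i j)) := by
    intro m hm' n hn h
    rw [Finset.coe_range, Set.mem_Iio] at hm' hn
    rw [← (length_altProd_of_le cs hm hm'.le).2, h, (length_altProd_of_le cs hm hn.le).2]
  rw [twistedPoincare_subgroup cs ρ (standardParabolic_mono cs (I := {i}) (by simp)),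
    twistedPoincare_standardParabolic_singleton, standardParabolic_inter_minimalReps cs hM hm,
    ← Finset.coe_range, twistedPoincare_image cs ρ _ hinj, altSum]
  congr 1
  exact Finset.sum_congr rfl fun n hn =>
    heckeTerm_altProd cs ρ hm (Finset.mem_range.1 hn).le

theorem powersSet_eq_union (w : W) : powersSet w = {1} ∪ Set.range fun n : ℕ => w ^ (n + 1) := by
  ext x
  rw [powersSet, Set.mem_range, ← Nat.or_exists_add_one, pow_zero, eq_comm]
  rfl

theorem twistedPoincare_powersSet_mul {ω : List B} (hω : IsStraightWord cs ω) (hne : ω ≠ []) :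
    twistedPoincare cs ρ (powersSet (cs.wordProd ω)) *
      (1 - (ω.map fun i => heckeTerm cs ρ (cs.simple i)).prod) = 1 := by
  set w := cs.wordProd ω
  have hlen (n : ℕ) : cs.length (w ^ n) = n * ω.length := hω.length_pow n
  have hdisj : Disjoint {1} (Set.range fun n : ℕ => w ^ (n + 1)) := by
    rw [Set.disjoint_singleton_left]
    rintro ⟨n, hn⟩
    have := congrArg cs.length hn
    simp [hlen, hne] at this
  have hshift : Set.BijOn (fun p : W × W => p.1 * p.2) (powersSet w ×ˢ {w})
      (Set.range fun n : ℕ => w ^ (n + 1)) := by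
    refine ⟨?_, ?_, ?_⟩
    · rintro ⟨_, _⟩ ⟨⟨n, rfl⟩, rfl⟩
      exact ⟨n, pow_succ w n⟩
    · rintro ⟨x, _⟩ ⟨-, rfl⟩ ⟨y, _⟩ ⟨-, rfl⟩ h
      exact Prod.ext (mul_right_cancel h) rfl
    · rintro _ ⟨n, rfl⟩
      exact ⟨(w ^ n, w), ⟨⟨n, rfl⟩, rfl⟩, (pow_succ w n).symm⟩
  have hadd : ∀ x ∈ powersSet w, ∀ y ∈ ({w} : Set W),
      cs.length (x * y) = cs.length x + cs.length y := by
    rintro _ ⟨n, rfl⟩ _ rfl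
    have h1 := hlen 1
    rw [pow_one] at h1
    rw [← pow_succ, hlen, hlen, h1]
    ring
  have hsum := twistedPoincare_union cs ρ hdisj
  rw [← powersSet_eq_union, twistedPoincare_mul cs ρ hshift hadd, twistedPoincare_singleton,
    twistedPoincare_singleton, heckeTerm_one, heckeTerm_wordProd cs ρ hω.isReduced] at hsum
  rw [mul_sub, mul_one, sub_eq_iff_eq_add]
  exact hsum

end Series

section PoincareSystem

variable {B R : Type*} [Fintype B] [DecidableEq B] [Ring R] {M : CoxeterMatrix B}

/-- Units `U I`, indexed by the subsets `I` of the generators, that satisfy the relations holding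
among the Poincaré series of the standard parabolic subgroups `W_I` of an infinite Coxeter group
whose rank-two parabolic subgroups are finite, with `a i` in the role of the term of the
generator `i`. -/
structure IsPoincareSystem (M : CoxeterMatrix B) (a : B → R) (U : Finset B → Rˣ) : Prop where
  empty : U ∅ = 1
  singleton (i : B) : (U {i} : R) = 1 + a i
  pair {i j : B} (hij : i ≠ j) : (U {i, j} : R) = (1 + a i) * altSum (a j) (a i) (M i j)
  sum_inv : ∑ I : Finset B, (-1) ^ I.card * (↑(U I)⁻¹ : R) = 0

namespace IsPoincareSystem

variable {a : B → R} {U : Finset B → Rˣ} (h : IsPoincareSystem M a U)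

include h

theorem pair_eq_add {i j : B} (hij : i ≠ j) :
    (U {i, j} : R) = altSum (a j) (a i) (M i j) + altSum (a i) (a j) (M i j) +
      altProd (a i) (a j) (M i j) - 1 := by
  rw [h.pair hij, one_add_mul_altSum]

theorem altProd_comm {i j : B} (hij : i ≠ j) :
    altProd (a i) (a j) (M i j) = altProd (a j) (a i) (M i j) := by
  have hji := h.pair_eq_add hij.symm
  rw [Finset.pair_comm, h.pair_eq_add hij, M.symmetric j i,
    add_comm (altSum (a i) (a j) (M i j))] at hji
  exact add_left_cancel (sub_left_injective hji)

theorem one_sub_inv_sub_inv_add_inv {i j : B} (hij : i ≠ j) :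
    1 - (↑(U {i})⁻¹ : R) - ↑(U {j})⁻¹ + ↑(U {i, j})⁻¹ =
      altProd (a i) (a j) (M i j) * ↑(U {i, j})⁻¹ := by
  have hi : (↑(U {i})⁻¹ : R) * U {i, j} = altSum (a j) (a i) (M i j) := by
    rw [h.pair hij, ← h.singleton, Units.inv_mul_cancel_left]
  have hj : (↑(U {j})⁻¹ : R) * U {i, j} = altSum (a i) (a j) (M i j) := by
    rw [Finset.pair_comm, h.pair hij.symm, ← h.singleton, Units.inv_mul_cancel_left, M.symmetric]
  rw [Units.eq_mul_inv_iff_mul_eq, add_mul, sub_mul, sub_mul, one_mul, Units.inv_mul, hi, hj,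
    h.pair_eq_add hij]
  abel

end IsPoincareSystem

end PoincareSystem

section RankThree

variable {R K : Type*} [Ring R] [CommRing K] {M : CoxeterMatrix (Fin 3)} {a : Fin 3 → R}
  {U : Finset (Fin 3) → Rˣ}

@[to_additive]
theorem prod_finset_fin_three {N : Type*} [CommMonoid N] (f : Finset (Fin 3) → N) :
    ∏ I, f I = f ∅ * f {0} * f {1} * f {2} * f {0, 1} * f {0, 2} * f {1, 2} * f Finset.univ := by
  have huniv : (Finset.univ : Finset (Finset (Fin 3))) =
      {∅, {0}, {1}, {2}, {0, 1}, {0, 2}, {1, 2}, Finset.univ} := by decide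
  rw [huniv]
  repeat rw [Finset.prod_insert (by decide)]
  simp only [Finset.prod_singleton, mul_assoc]

theorem IsPoincareSystem.inv_univ (h : IsPoincareSystem M a U) :
    (↑(U Finset.univ)⁻¹ : R) = altProd (a 1) (a 2) (M 1 2) * ↑(U {1, 2})⁻¹ - ↑(U {0})⁻¹ +
      ↑(U {0, 1})⁻¹ + ↑(U {0, 2})⁻¹ := by
  have hsum := h.sum_inv
  simp only [sum_finset_fin_three, Finset.card_empty, Finset.card_singleton, h.empty, inv_one,
    Units.val_one, Finset.card_univ, Fintype.card_fin, pow_zero, pow_one, one_mul, neg_one_mul,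
    Finset.card_pair (show (0 : Fin 3) ≠ 1 by decide),
    Finset.card_pair (show (0 : Fin 3) ≠ 2 by decide),
    Finset.card_pair (show (1 : Fin 3) ≠ 2 by decide), neg_one_sq,
    (show Odd 3 by decide).neg_one_pow] at hsum
  rw [← h.one_sub_inv_sub_inv_add_inv (by decide), ← sub_eq_zero, ← neg_eq_zero, ← hsum]
  abel

/-- The element `(1 + a)⁻¹ W_{ac} · W⁻¹ · W_{ab}` of a Poincaré system of rank three with
generators `a, b, c`, written with `z = (1 + b)⁻¹ W_{bc}` so that `z⁻¹` is the only inverse in it.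
Its determinant differs from that of `W⁻¹` by rank-one and rank-two factors. -/
def clearedInverse (a b c : R) (z : Rˣ) (mab mac mbc : ℕ) : R :=
  altSum c a mac + altSum b a mab - altSum c a mac * altSum b a mab +
    altSum c a mac * altProd b c mbc * ↑z⁻¹ * altSum a b mab

namespace IsPoincareSystem

variable (h : IsPoincareSystem M a U) {z : Rˣ} (hz : (z : R) = altSum (a 2) (a 1) (M 1 2))

include h hz

theorem pair_one_two : U {1, 2} = U {1} * z := by
  rw [Units.ext_iff, h.pair (by decide), Units.val_mul, h.singleton, hz]

theorem clearedInverse_eq :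
    clearedInverse (a 0) (a 1) (a 2) z (M 0 1) (M 0 2) (M 1 2) =
      altSum (a 2) (a 0) (M 0 2) * ↑(U Finset.univ)⁻¹ * U {0, 1} := by
  have hba : (U {0, 1} : R) = U {1} * altSum (a 0) (a 1) (M 0 1) := by
    rw [Finset.pair_comm, h.pair (by decide), h.singleton, M.symmetric 1 0]
  have hr : (↑(U {0})⁻¹ : R) * U {0, 1} = altSum (a 1) (a 0) (M 0 1) := by
    rw [h.pair (by decide), ← h.singleton, Units.inv_mul_cancel_left]
  have hp : altSum (a 2) (a 0) (M 0 2) = ↑(U {0})⁻¹ * U {0, 2} := by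
    rw [h.pair (by decide), ← h.singleton, Units.inv_mul_cancel_left]
  have hp' : altSum (a 2) (a 0) (M 0 2) * (↑(U {0, 2})⁻¹ * U {0, 1}) =
      altSum (a 1) (a 0) (M 0 1) := by
    rw [hp, mul_assoc, Units.mul_inv_cancel_left, hr]
  have hz' : (↑(U {1, 2})⁻¹ : R) * U {0, 1} = ↑z⁻¹ * altSum (a 0) (a 1) (M 0 1) := by
    rw [hba, h.pair_one_two hz, mul_inv_rev, Units.val_mul, mul_assoc, Units.inv_mul_cancel_left]
  rw [clearedInverse, mul_assoc _ (↑(U Finset.univ)⁻¹ : R), h.inv_univ, add_mul, add_mul, sub_mul,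
    hr, Units.inv_mul, mul_assoc (altProd (a 1) (a 2) (M 1 2)), hz', mul_add, mul_add, mul_sub, hp']
  noncomm_ring

theorem map_clearedInverse_mul (d : R →* K) :
    d (clearedInverse (a 0) (a 1) (a 2) z (M 0 1) (M 0 2) (M 1 2)) * d z *
        (d (U Finset.univ) * d (U {0}) * d (U {1})) =
      d (U {0, 1}) * d (U {0, 2}) * d (U {1, 2}) := by
  have hac : (U {0, 2} : R) = U {0} * altSum (a 2) (a 0) (M 0 2) := by
    rw [h.pair (by decide), h.singleton]
  have hinv : d ↑(U Finset.univ)⁻¹ * d (U Finset.univ) = 1 := by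
    rw [← map_mul, Units.inv_mul, map_one]
  rw [h.clearedInverse_eq hz, hac, h.pair_one_two hz]
  simp only [map_mul, Units.val_mul]
  linear_combination d (altSum (a 2) (a 0) (M 0 2)) * d (U {0, 1}) * d z * d (U {0}) * d (U {1}) *
    hinv

end IsPoincareSystem

end RankThree

section Factorization

variable {R K : Type*} [Ring R] [CommRing K] {a b c : R} {z : Rˣ}

theorem clearedInverse_A2 (hz : (z : R) = altSum c b 3)
    (hab : altProd a b 3 = altProd b a 3) (hbc : altProd b c 3 = altProd c b 3) :
    clearedInverse a b c z 3 3 3 =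
      (1 - c * a * b) * (1 - c * b * (↑z⁻¹ * altSum a b 3)) := by
  have hzinv : altSum c b 3 * (↑z⁻¹ : R) = 1 := by rw [← hz, Units.mul_inv]
  simp only [clearedInverse, altSum, altProd, Finset.sum_range_succ, Finset.sum_range_zero,
    mul_one, zero_add] at *
  linear_combination (norm := noncomm_ring) c * b * hzinv * (1 + a + a * b)
      + hbc * (↑z⁻¹ : R) * (1 + a + a * b) - c * hab

theorem map_clearedInverse_A2 (d : R →* K) (hd : ∀ x y, d (1 - x * y) = d (1 - y * x))
    (hz : (z : R) = altSum c b 3)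
    (hab : altProd a b 3 = altProd b a 3) (hbc : altProd b c 3 = altProd c b 3) :
    d (clearedInverse a b c z 3 3 3) * d z =
      d (1 + c) * (d (1 - c * b * a) * d (1 - c * a * b)) := by
  have hclear : (z : R) * (1 - ↑z⁻¹ * altSum a b 3 * (c * b)) = (1 - a * (c * b)) * (1 + c) := by
    rw [mul_sub, mul_one, mul_assoc, Units.mul_inv_cancel_left, hz]
    simp only [altSum, altProd, Finset.sum_range_succ, Finset.sum_range_zero, mul_one, zero_add]
      at *
    linear_combination (norm := noncomm_ring) - a * hbc
  have hdet : d (1 - c * b * (↑z⁻¹ * altSum a b 3)) * d z = d (1 - c * b * a) * d (1 + c) := by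
    rw [hd, mul_comm, ← map_mul, hclear, map_mul, hd]
  rw [clearedInverse_A2 hz hab hbc, map_mul]
  linear_combination d (1 - c * a * b) * hdet

theorem clearedInverse_C2 (hz : (z : R) = altSum c b 2)
    (hab : altProd a b 4 = altProd b a 4) (hbc : altProd b c 2 = altProd c b 2) :
    clearedInverse a b c z 4 4 2 =
      (1 - c * a * b) * (1 - c * a * b * a) := by
  have hzinv : altSum c b 2 * (↑z⁻¹ : R) = 1 := by rw [← hz, Units.mul_inv]
  have hclear : altSum c a 4 * altProd b c 2 * ↑z⁻¹ = (c + c * a * c) * b := by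
    simp only [altSum, altProd, Finset.sum_range_succ, Finset.sum_range_zero, mul_one, zero_add]
      at *
    linear_combination (norm := noncomm_ring) -(1 + c * a) * hbc * c * ↑z⁻¹
      + (1 + c * a) * b * c * hzinv + (1 + c * a) * hbc
  rw [clearedInverse, hclear]
  simp only [altSum, altProd, Finset.sum_range_succ, Finset.sum_range_zero, mul_one, zero_add]
    at *
  linear_combination (norm := noncomm_ring) - c * hab - c * a * hbc * a * b * a

theorem map_clearedInverse_C2 (d : R →* K) (hz : (z : R) = altSum c b 2)
    (hab : altProd a b 4 = altProd b a 4) (hbc : altProd b c 2 = altProd c b 2) :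
    d (clearedInverse a b c z 4 4 2) * d z =
      d (1 + c) * (d (1 - c * a * b * a) * d (1 - c * a * b)) := by
  have hz' : (z : R) = 1 + c := by simpa [altSum, Finset.sum_range_succ, altProd] using hz
  rw [clearedInverse_C2 hz hab hbc, map_mul, hz']
  ring

theorem clearedInverse_G2 (hz : (z : R) = altSum c b 2)
    (hab : altProd a b 6 = altProd b a 6) (hbc : altProd b c 2 = altProd c b 2) :
    clearedInverse a b c z 6 3 2 =
      1 - c * a * ↑z⁻¹ * (b * (altSum a b 4 - c * a * b * a * b * (1 + a))) := by
  have hzinv : altSum c b 2 * (↑z⁻¹ : R) = 1 := by rw [← hz, Units.mul_inv]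
  have hinvz : (↑z⁻¹ : R) * altSum c b 2 = 1 := by rw [← hz, Units.inv_mul]
  simp only [clearedInverse, altSum, altProd, Finset.sum_range_succ, Finset.sum_range_zero,
    mul_one, zero_add] at *
  have hcomm : b * (↑z⁻¹ : R) = ↑z⁻¹ * b := by
    linear_combination (norm := noncomm_ring) - hinvz * b * ↑z⁻¹ + (↑z⁻¹ : R) * b * hzinv
      - (↑z⁻¹ : R) * hbc * ↑z⁻¹
  have hclear : (1 + c + c * a) * (b * c) * ↑z⁻¹ = c * b + c * a * b - c * a * b * ↑z⁻¹ := by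
    linear_combination (norm := noncomm_ring) - hbc * c * ↑z⁻¹ + b * c * hzinv + hbc
      + c * a * b * hzinv
  rw [hclear]
  linear_combination (norm := noncomm_ring) - c * hab - c * a * hcomm *
      (1 + a + a * b + a * b * a - c * a * b * a * b - c * a * b * a * b * a)
        - c * a * b * hinvz * (a * b * a * b + a * b * a * b * a)

theorem map_clearedInverse_G2 (d : R →* K) (hd : ∀ x y, d (1 - x * y) = d (1 - y * x))
    (hz : (z : R) = altSum c b 2) (hab : altProd a b 6 = altProd b a 6)
    (hac : altProd a c 3 = altProd c a 3) (hbc : altProd b c 2 = altProd c b 2) :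
    d (clearedInverse a b c z 6 3 2) * d z =
      d (1 + c) * (d (1 - c * a * b) * d (1 - c * a * b * a * b)) := by
  set e := altSum a b 4 - c * a * b * a * b * (1 + a) with he
  have hz' : (z : R) = 1 + c := by simpa [altSum, Finset.sum_range_succ, altProd] using hz
  have hclear : (1 - b * e * (c * a * ↑z⁻¹)) * z =
      (1 - b * (c * a)) * (1 - b * a * b * (c * a)) * (1 + c) := by
    rw [sub_mul, one_mul, ← mul_assoc, Units.inv_mul_cancel_right, hz', he]
    simp only [altSum, altProd, Finset.sum_range_succ, Finset.sum_range_zero, mul_one, zero_add]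
      at *
    linear_combination (norm := noncomm_ring)
      - b * hac - b * a * b * hac + b * c * a * b * a * b * hac
  rw [clearedInverse_G2 hz hab hbc, hd, ← map_mul, hclear, map_mul, map_mul, hd b,
    hd (b * a * b)]
  simp only [mul_assoc]
  ring

end Factorization

theorem AffineType.map_poincareSystem (T : AffineType) {R K : Type*} [Ring R] [CommRing K]
    {a : Fin 3 → R} {U : Finset (Fin 3) → Rˣ} (h : IsPoincareSystem T.coxeterMatrix a U)
    (d : R →* K) (hd : ∀ x y, d (1 - x * y) = d (1 - y * x)) :
    d (U {0, 1}) * d (U {0, 2}) * d (U {1, 2}) =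
      d (U Finset.univ) * d (U {0}) * d (U {1}) * d (U {2}) *
        (d (1 - ((stripWord₁ T).map a).prod) * d (1 - ((stripWord₂ T).map a).prod)) := by
  obtain ⟨z, hz⟩ : ∃ z : Rˣ, (z : R) = altSum (a 2) (a 1) (T.coxeterMatrix 1 2) :=
    ⟨(U {1})⁻¹ * U {1, 2}, by
      rw [Units.val_mul, h.pair (by decide), ← h.singleton, Units.inv_mul_cancel_left]⟩
  have hab := h.altProd_comm (show (0 : Fin 3) ≠ 1 by decide)
  have hac := h.altProd_comm (show (0 : Fin 3) ≠ 2 by decide)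
  have hbc := h.altProd_comm (show (1 : Fin 3) ≠ 2 by decide)
  have hfactor : d (clearedInverse (a 0) (a 1) (a 2) z (T.coxeterMatrix 0 1)
      (T.coxeterMatrix 0 2) (T.coxeterMatrix 1 2)) * d z = d (U {2}) *
        (d (1 - ((stripWord₁ T).map a).prod) * d (1 - ((stripWord₂ T).map a).prod)) := by
    rw [h.singleton]
    cases T
    · exact (map_clearedInverse_A2 d hd hz hab hbc).trans
        (by simp [stripWord₁, stripWord₂, mul_assoc])
    · exact (map_clearedInverse_C2 d hz hab hbc).trans
        (by simp [stripWord₁, stripWord₂, mul_assoc])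
    · exact (map_clearedInverse_G2 d hd hz hab hac hbc).trans
        (by simp [stripWord₁, stripWord₂, mul_assoc])
  rw [← h.map_clearedInverse_mul hz d, hfactor]
  ring

section ParabolicUnit

variable {B : Type*} [Finite B] {M : CoxeterMatrix B} {W : Type*} [Group W] {k : Type*} [Field k]
  (cs : CoxeterSystem M W) {q : k} {V : Type*} [AddCommGroup V] [Module k V]
  (ρ : HeckeAlgebra cs q →ₐ[k] Module.End k V)

theorem isUnit_twistedPoincare {D : Set W} (hD : 1 ∈ D) : IsUnit (twistedPoincare cs ρ D) := by
  rw [isUnit_iff_constantCoeff, ← coeff_zero_eq_constantCoeff_apply,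
    coeff_zero_twistedPoincare cs ρ D hD]
  exact isUnit_one

/-- The Poincaré series of the standard parabolic subgroup `W_I`, as a unit. -/
noncomputable def parabolicUnit (I : Finset B) : (PowerSeries (Module.End k V))ˣ :=
  (isUnit_twistedPoincare cs ρ (one_mem (standardParabolic cs (I : Set B)))).unit

theorem val_parabolicUnit (I : Finset B) :
    (parabolicUnit cs ρ I : PowerSeries (Module.End k V)) =
      twistedPoincare cs ρ (standardParabolic cs (I : Set B)) := rfl

theorem parabolicUnit_empty : parabolicUnit cs ρ ∅ = 1 := by
  ext1
  rw [val_parabolicUnit, Finset.coe_empty, standardParabolic, Set.image_empty,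
    Subgroup.closure_empty, Subgroup.coe_bot, twistedPoincare_singleton, heckeTerm_one,
    Units.val_one]

theorem twistedPoincare_minimalReps (I : Finset B) :
    twistedPoincare cs ρ (minimalReps cs I) =
      ↑(parabolicUnit cs ρ I)⁻¹ * twistedPoincare cs ρ Set.univ := by
  have h := twistedPoincare_subgroup cs ρ (le_top : standardParabolic cs (I : Set B) ≤ ⊤)
  rw [Units.eq_inv_mul_iff_mul_eq, val_parabolicUnit]
  simpa using h.symm

end ParabolicUnit

section InclusionExclusion

variable {B : Type*} [Fintype B] {M : CoxeterMatrix B} {W : Type*} [Group W] {k : Type*} [Field k]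
  (cs : CoxeterSystem M W) {q : k} {V : Type*} [AddCommGroup V] [Module k V]
  (ρ : HeckeAlgebra cs q →ₐ[k] Module.End k V)

theorem sum_neg_one_pow_card_mul_twistedPoincare_minimalReps :
    ∑ I : Finset B, (-1) ^ I.card * twistedPoincare cs ρ (minimalReps cs I) =
      twistedPoincare cs ρ {w | ∀ i, cs.IsLeftDescent w i} := by
  classical
  ext1 n
  have hsign (I : Finset B) (F : PowerSeries (Module.End k V)) :
      coeff n ((-1) ^ I.card * F) = (-1 : ℤ) ^ I.card • coeff n F := by
    rw [← map_zsmul, zsmul_eq_mul, Int.cast_pow, Int.cast_neg, Int.cast_one]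
  simp only [map_sum, hsign, coeff_twistedPoincare, Finset.smul_sum]
  rw [Finset.sum_comm]
  refine Finset.sum_congr rfl fun w _ => ?_
  have hmem (I : Finset B) : w ∈ minimalReps cs (I : Set B) ↔
      I ∈ (Finset.univ.filter fun i => ¬ cs.IsLeftDescent w i).powerset := by
    simp [minimalReps, Finset.subset_iff]
  simp only [hmem, smul_ite, smul_zero, ← Finset.sum_filter, Finset.filter_univ_mem]
  rw [← Finset.sum_smul, Finset.sum_powerset_neg_one_pow_card, ite_smul, one_smul, zero_smul]
  simp [Finset.filter_eq_empty_iff]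

theorem sum_neg_one_pow_card_mul_twistedPoincare_minimalReps_eq_zero
    (h : ∀ n, ∃ w, n < cs.length w) :
    ∑ I : Finset B, (-1) ^ I.card * twistedPoincare cs ρ (minimalReps cs I) = 0 := by
  have hempty : {w | ∀ i, cs.IsLeftDescent w i} = ∅ := by
    refine Set.eq_empty_of_forall_notMem fun w hw => ?_
    obtain ⟨x, hx⟩ := h (cs.length w)
    have := length_eq_add_of_forall_isLeftDescent cs hw x
    lia
  rw [sum_neg_one_pow_card_mul_twistedPoincare_minimalReps, hempty, twistedPoincare_empty]

theorem isPoincareSystem_parabolicUnit [DecidableEq B] (h : ∀ n, ∃ w, n < cs.length w)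
    (hM : ∀ i j, M i j ≠ 0)
    (hm : ∀ i j, cs.length (altProd (cs.simple i) (cs.simple j) (M i j)) = M i j) :
    IsPoincareSystem M (fun i => heckeTerm cs ρ (cs.simple i)) (parabolicUnit cs ρ) where
  empty := parabolicUnit_empty cs ρ
  singleton i := by
    rw [val_parabolicUnit, Finset.coe_singleton, twistedPoincare_standardParabolic_singleton]
  pair {i j} _ := by
    rw [val_parabolicUnit, Finset.coe_pair,
      twistedPoincare_standardParabolic_pair cs ρ (hM i j) (hm i j)]
  sum_inv := by
    have hsum := sum_neg_one_pow_card_mul_twistedPoincare_minimalReps_eq_zero cs ρ h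
    simp only [twistedPoincare_minimalReps, ← mul_assoc, ← Finset.sum_mul] at hsum
    exact (isUnit_twistedPoincare cs ρ (Set.mem_univ 1)).mul_left_eq_zero.1 hsum

end InclusionExclusion

section Determinant

variable {k : Type*} [Field k] {V : Type*} [AddCommGroup V] [Module k V]

/-- `seriesMatrix` as a ring homomorphism. -/
noncomputable def seriesMatrixHom {ι : Type*} [Fintype ι] [DecidableEq ι]
    (b : Module.Basis ι k V) : PowerSeries (Module.End k V) →+* Matrix ι ι k⟦X⟧ where
  toFun := seriesMatrix b
  map_zero' := by
    ext i j n
    simp [seriesMatrix]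
  map_one' := by
    ext i j n
    rcases eq_or_ne n 0 with rfl | hn
    · simp [seriesMatrix, LinearMap.toMatrix_one, Matrix.one_apply, apply_ite]
    · rcases eq_or_ne i j with rfl | hij <;>
        simp [seriesMatrix, PowerSeries.coeff_one, *]
  map_add' F G := by
    ext i j n
    simp [seriesMatrix]
  map_mul' := seriesMatrix_mul b

variable [FiniteDimensional k V]

/-- `seriesDet` as a monoid homomorphism. -/
noncomputable def seriesDetHom : PowerSeries (Module.End k V) →* k⟦X⟧ :=
  Matrix.detMonoidHom.comp (seriesMatrixHom (Module.finBasis k V)).toMonoidHom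

theorem seriesDetHom_apply (F : PowerSeries (Module.End k V)) : seriesDetHom F = seriesDet F := rfl

theorem seriesDetHom_one_sub_mul_comm (F G : PowerSeries (Module.End k V)) :
    seriesDetHom (1 - F * G) = seriesDetHom (1 - G * F) := by
  have h (F G : PowerSeries (Module.End k V)) : seriesDetHom (1 - F * G) =
      (1 - seriesMatrix (Module.finBasis k V) F * seriesMatrix (Module.finBasis k V) G).det := by
    rw [← seriesMatrix_mul, ← map_one (seriesMatrixHom (Module.finBasis k V))]
    exact congrArg Matrix.det (map_sub (seriesMatrixHom (Module.finBasis k V)) 1 (F * G))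
  rw [h, h, Matrix.det_one_sub_mul_comm]

end Determinant

section Main

variable {W : Type*} [Group W] {k : Type*} [Field k] {q : k} {V : Type*} [AddCommGroup V]
  [Module k V]

theorem AffineType.exists_lt_length (T : AffineType) (cs : CoxeterSystem T.coxeterMatrix W)
    (n : ℕ) : ∃ w, n < cs.length w := by
  refine ⟨cs.wordProd T.stripWord₁ ^ (n + 1), ?_⟩
  rw [(T.isStraightWord_stripWord₁ cs).length_pow]
  exact Nat.le_mul_of_pos_right _ (List.length_pos_of_ne_nil T.stripWord₁_ne_nil)

variable [FiniteDimensional k V]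

theorem seriesDet_powersSet_mul {B : Type*} [Finite B] {M : CoxeterMatrix B}
    (cs : CoxeterSystem M W) (ρ : HeckeAlgebra cs q →ₐ[k] Module.End k V) {ω : List B}
    (hω : IsStraightWord cs ω) (hne : ω ≠ []) :
    seriesDet (twistedPoincare cs ρ (powersSet (cs.wordProd ω))) *
      seriesDetHom (1 - (ω.map fun i => heckeTerm cs ρ (cs.simple i)).prod) = 1 := by
  rw [← seriesDetHom_apply, ← map_mul, twistedPoincare_powersSet_mul cs ρ hω hne, map_one]

section RankThree

variable {M : CoxeterMatrix (Fin 3)} (cs : CoxeterSystem M W)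
  (ρ : HeckeAlgebra cs q →ₐ[k] Module.End k V)

/-- The determinant `det W_I(ρ, u)` for a standard parabolic subgroup `W_I`. -/
noncomputable def parabolicDet (I : Finset (Fin 3)) : k⟦X⟧ :=
  seriesDet (twistedPoincare cs ρ (parabolic cs I))

theorem seriesDetHom_parabolicUnit (I : Finset (Fin 3)) :
    seriesDetHom (parabolicUnit cs ρ I : PowerSeries (Module.End k V)) = parabolicDet cs ρ I := rfl

theorem parabolicDet_empty : parabolicDet cs ρ ∅ = 1 := by
  rw [← seriesDetHom_parabolicUnit, parabolicUnit_empty, Units.val_one, map_one]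

theorem constantCoeff_parabolicDet (I : Finset (Fin 3)) :
    constantCoeff (parabolicDet cs ρ I) = 1 :=
  constantCoeff_seriesDet _ (coeff_zero_twistedPoincare cs ρ _ (one_mem _))

theorem parabolicDet_inv_mul (I : Finset (Fin 3)) :
    (parabolicDet cs ρ I)⁻¹ * parabolicDet cs ρ I = 1 :=
  PowerSeries.inv_mul_cancel _ (by rw [constantCoeff_parabolicDet]; exact one_ne_zero)

theorem parabolicDet_ne_zero (I : Finset (Fin 3)) : parabolicDet cs ρ I ≠ 0 :=
  right_ne_zero_of_mul_eq_one (parabolicDet_inv_mul cs ρ I)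

theorem detAlt_mul :
    detAlt cs ρ * (parabolicDet cs ρ {0, 1} * parabolicDet cs ρ {0, 2} * parabolicDet cs ρ {1, 2}) =
      parabolicDet cs ρ Finset.univ * parabolicDet cs ρ {0} * parabolicDet cs ρ {1} *
        parabolicDet cs ρ {2} := by
  set δ := parabolicDet cs ρ
  have hinv (I : Finset (Fin 3)) : (δ I)⁻¹ * δ I = 1 := parabolicDet_inv_mul cs ρ I
  have hempty : (δ ∅)⁻¹ = 1 := by
    simpa only [δ, parabolicDet_empty, mul_one] using hinv ∅
  have hdetAlt : detAlt cs ρ =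
      ∏ I : Finset (Fin 3), if Even (I.card + 3) then δ I else (δ I)⁻¹ := rfl
  rw [hdetAlt, prod_finset_fin_three, if_neg (by decide), if_pos (by decide), if_pos (by decide),
    if_pos (by decide), if_neg (by decide), if_neg (by decide), if_neg (by decide),
    if_pos (by decide), hempty]
  calc _ = δ Finset.univ * δ {0} * δ {1} * δ {2} *
        (((δ {0, 1})⁻¹ * δ {0, 1}) * ((δ {0, 2})⁻¹ * δ {0, 2}) * ((δ {1, 2})⁻¹ * δ {1, 2})) := by
        ring
    _ = _ := by rw [hinv, hinv, hinv, mul_one, mul_one, mul_one]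

end RankThree

end Main

theorem mainTheorem3 {W : Type*} [Group W] (T : AffineType)
    (cs : CoxeterSystem T.coxeterMatrix W) {k : Type*} [Field k] (q : k)
    {V : Type*} [AddCommGroup V] [Module k V] [FiniteDimensional k V]
    (ρ : HeckeAlgebra cs q →ₐ[k] Module.End k V) :
    seriesDet (twistedPoincare cs ρ (powersSet (stripElement₁ T cs))) *
        seriesDet (twistedPoincare cs ρ (powersSet (stripElement₂ T cs))) =
      detAlt cs ρ := by
  have hstrip₁ := seriesDet_powersSet_mul cs ρ (T.isStraightWord_stripWord₁ cs)
    T.stripWord₁_ne_nil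
  have hstrip₂ := seriesDet_powersSet_mul cs ρ (T.isStraightWord_stripWord₂ cs)
    T.stripWord₂_ne_nil
  have hsystem := isPoincareSystem_parabolicUnit cs ρ (T.exists_lt_length cs)
    T.coxeterMatrix_ne_zero (T.length_altProd_simple cs)
  have hdet := T.map_poincareSystem hsystem seriesDetHom seriesDetHom_one_sub_mul_comm
  simp only [seriesDetHom_parabolicUnit] at hdet
  rw [T.wordProd_stripWord₁ cs] at hstrip₁
  rw [T.wordProd_stripWord₂ cs] at hstrip₂
  refine mul_right_cancel₀ (mul_ne_zero (mul_ne_zero (parabolicDet_ne_zero cs ρ {0, 1})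
    (parabolicDet_ne_zero cs ρ {0, 2})) (parabolicDet_ne_zero cs ρ {1, 2})) ?_
  rw [detAlt_mul, hdet, mul_left_comm, mul_mul_mul_comm (seriesDet _), hstrip₁, hstrip₂, mul_one,
    mul_one]
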